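/- Let $H$ be a Hilbert $C^*$-module over a $C^*$-algebra $\mathfrak A$ (not necessarily unital), and let $\mathcal L(H)$ be the $C^*$-algebra of all adjointable operators on $H$, with identity $I$. For $T\in\mathcal L(H)$ let $\mathcal R(T)$ be its range, $T^*$ its adjoint and $|T|=(T^*T)^{1/2}$. A closed submodule $M\subseteq H$ is called orthogonally complemented if $H=M+M^\perp$, where $M^\perp=\{x\in H:\langle x,y\rangle=0 \text{ for all } y\in M\}$; in this case $P_M\in\mathcal L(H)$ denotes the projection of $H$ onto $M$. An operator $T\in\mathcal L(H)$ is said to have the polar decomposition if there is a partial isometry $U\in\mathcal L(H)$ such that $T=U|T|$ and $U^*U=P_{\overline{\mathcal R(T^*)}}$ (in particular, $\overline{\mathcal R(T^*)}$ is orthogonally complemented). A pair $(P,Q)$ is called a quasi-projection pair on $H$ if $P\in\mathcal L(H)$ is a projection ($P=P^*=P^2$) and $Q\in\mathcal L(H)$ is an idempotent ($Q^2=Q$) such that $$PQ^*P=PQP,\qquad PQ^*(I-P)=-PQ(I-P),\qquad (I-P)Q^*(I-P)=(I-P)Q(I-P).$$ A quasi-projection pair $(P,Q)$ is called semi-harmonious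 if $P(I-Q)$ and $(I-P)Q$ both have the polar decomposition, and it is called harmonious if $\overline{\mathcal R(PQ(I-P))}$ and $\overline{\mathcal R((I-P)QP)}$ are both orthogonally complemented in $H$. **Theorem.** For every quasi-projection pair $(P,Q)$ on $H$, the pair $(P,Q)$ is harmonious if and only if $(P,Q)$ and $(P,I-Q)$ are both semi-harmonious quasi-projection pairs. -/

import Mathlib

section AdjointableOperators

variable {A H : Type*} [NonUnitalCStarAlgebra A] [PartialOrder A] [StarOrderedRing A]
  [NormedAddCommGroup H] [NormedSpace ℂ H] [SMul A H] [CStarModule A H]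

/-- `S` is an adjoint of `T` with respect to the `A`-valued inner product:
`⟨T x, y⟩ = ⟨x, S y⟩` for all `x`, `y`. -/
def IsAdjointOf (A : Type*) {H : Type*} [NonUnitalCStarAlgebra A] [PartialOrder A]
    [StarOrderedRing A] [NormedAddCommGroup H] [NormedSpace ℂ H] [SMul A H] [CStarModule A H]
    (T S : H →L[ℂ] H) : Prop :=
  ∀ x y : H, inner A (T x) y = inner A x (S y)

theorem eq_of_inner_eq {x y : H} (h : ∀ z : H, inner A z x = inner A z y) : x = y := by
  rw [← sub_eq_zero, ← CStarModule.inner_self (A := A), CStarModule.inner_sub_right, h, sub_self]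

theorem IsAdjointOf.unique {T S S' : H →L[ℂ] H} (h : IsAdjointOf A T S)
    (h' : IsAdjointOf A T S') : S = S' := by
  ext y
  exact eq_of_inner_eq (A := A) fun z => by rw [← h, ← h']

theorem IsAdjointOf.symm {T S : H →L[ℂ] H} (h : IsAdjointOf A T S) : IsAdjointOf A S T :=
  fun x y => by rw [← CStarModule.star_inner, ← h, CStarModule.star_inner]

theorem IsAdjointOf.mul {T S T' S' : H →L[ℂ] H} (h : IsAdjointOf A T S)
    (h' : IsAdjointOf A T' S') : IsAdjointOf A (T * T') (S' * S) :=
  fun x y => by simp only [mul_apply_eq_comp, h _ _, h' _ _]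

theorem IsAdjointOf.add {T S T' S' : H →L[ℂ] H} (h : IsAdjointOf A T S)
    (h' : IsAdjointOf A T' S') : IsAdjointOf A (T + T') (S + S') :=
  fun x y => by simp [h x y, h' x y]

theorem IsAdjointOf.smul {T S : H →L[ℂ] H} (h : IsAdjointOf A T S) (c : ℂ) :
    IsAdjointOf A (c • T) (star c • S) :=
  fun x y => by simp [h x y]

theorem isAdjointOf_one : IsAdjointOf A (1 : H →L[ℂ] H) 1 := fun _ _ => rfl

theorem isAdjointOf_zero : IsAdjointOf A (0 : H →L[ℂ] H) 0 := fun _ _ => by simp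

theorem IsAdjointOf.norm_sq_le {T S : H →L[ℂ] H} (h : IsAdjointOf A T S) :
    ‖T‖ * ‖T‖ ≤ ‖S * T‖ := by
  rw [← sq, ← Real.le_sqrt (norm_nonneg _) (norm_nonneg _)]
  refine ContinuousLinearMap.opNorm_le_bound _ (Real.sqrt_nonneg _) fun x => ?_
  have h1 : ‖T x‖ ^ 2 ≤ ‖S * T‖ * ‖x‖ ^ 2 := by
    calc ‖T x‖ ^ 2 = ‖inner A x ((S * T) x)‖ := by
          rw [CStarModule.norm_sq_eq A, h]; rfl
      _ ≤ ‖x‖ * ‖(S * T) x‖ := CStarModule.norm_inner_le H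
      _ ≤ ‖x‖ * (‖S * T‖ * ‖x‖) := by gcongr; exact (S * T).le_opNorm x
      _ = ‖S * T‖ * ‖x‖ ^ 2 := by ring
  calc ‖T x‖ = √(‖T x‖ ^ 2) := (Real.sqrt_sq (norm_nonneg _)).symm
    _ ≤ √(‖S * T‖ * ‖x‖ ^ 2) := Real.sqrt_le_sqrt h1
    _ = √‖S * T‖ * ‖x‖ := by
      rw [Real.sqrt_mul (norm_nonneg _), Real.sqrt_sq (norm_nonneg _)]

theorem IsAdjointOf.norm_le {T S : H →L[ℂ] H} (h : IsAdjointOf A T S) : ‖T‖ ≤ ‖S‖ := by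
  rcases (norm_nonneg T).eq_or_lt with h0 | h0
  · rw [← h0]; exact norm_nonneg S
  · exact le_of_mul_le_mul_right (h.norm_sq_le.trans (norm_mul_le S T)) h0

theorem IsAdjointOf.norm_eq {T S : H →L[ℂ] H} (h : IsAdjointOf A T S) : ‖T‖ = ‖S‖ :=
  le_antisymm h.norm_le h.symm.norm_le

variable (A H) in
/-- The algebra `𝓛(H)` of all adjointable operators on the `A`-module `H`. (On a Hilbert
`C⋆`-module a map having an adjoint is automatically linear and bounded.) -/
noncomputable def Adjointable : Subalgebra ℂ (H →L[ℂ] H) where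
  carrier := {T | ∃ S, IsAdjointOf A T S}
  mul_mem' := fun ⟨S, h⟩ ⟨S', h'⟩ => ⟨S' * S, h.mul h'⟩
  add_mem' := fun ⟨S, h⟩ ⟨S', h'⟩ => ⟨S + S', h.add h'⟩
  algebraMap_mem' := fun c => ⟨star c • 1, by
    rw [Algebra.algebraMap_eq_smul_one]; exact isAdjointOf_one.smul c⟩

/-- The adjoint `T*` of an adjointable operator `T`. -/
noncomputable instance : Star (Adjointable A H) where
  star T := ⟨T.2.choose, T.1, T.2.choose_spec.symm⟩

theorem isAdjointOf_star (T : Adjointable A H) :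
    IsAdjointOf A (T : H →L[ℂ] H) (star T : Adjointable A H) := T.2.choose_spec

theorem adjointable_star_eq_of {T S : Adjointable A H}
    (h : IsAdjointOf A (T : H →L[ℂ] H) (S : H →L[ℂ] H)) : star T = S :=
  Subtype.ext ((isAdjointOf_star T).unique h)

noncomputable instance : StarRing (Adjointable A H) where
  star_involutive T := adjointable_star_eq_of (isAdjointOf_star T).symm
  star_mul T S := adjointable_star_eq_of ((isAdjointOf_star T).mul (isAdjointOf_star S))
  star_add T S := adjointable_star_eq_of ((isAdjointOf_star T).add (isAdjointOf_star S))

instance : StarModule ℂ (Adjointable A H) where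
  star_smul c T := adjointable_star_eq_of ((isAdjointOf_star T).smul c)

instance : CStarRing (Adjointable A H) where
  norm_mul_self_le T := (isAdjointOf_star T).norm_sq_le

theorem isClosed_adjointable [CompleteSpace H] :
    IsClosed (Adjointable A H : Set (H →L[ℂ] H)) := by
  refine isClosed_of_closure_subset fun T hT => ?_
  obtain ⟨u, hu, hlim⟩ := mem_closure_iff_seq_limit.1 hT
  choose v hv using hu
  have hc : CauchySeq v := by
    have h1 := hlim.cauchySeq
    rw [Metric.cauchySeq_iff] at h1 ⊢
    intro ε hε
    obtain ⟨N, hN⟩ := h1 ε hε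
    refine ⟨N, fun m hm n hn => ?_⟩
    have h2 : IsAdjointOf A (u m - u n) (v m - v n) := fun x y => by
      simp [hv m x y, hv n x y]
    have h3 := hN m hm n hn
    rw [dist_eq_norm] at h3 ⊢
    rwa [← h2.norm_eq]
  obtain ⟨S, hS⟩ := cauchySeq_tendsto_of_complete hc
  refine ⟨S, fun x y => ?_⟩
  have e1 : Filter.Tendsto (fun n => inner A (u n x) y) Filter.atTop
      (nhds (inner A (T x) y)) :=
    ((CStarModule.continuous_inner (A := A) (E := H)).tendsto (T x, y)).comp
      ((((ContinuousLinearMap.apply ℂ H x).continuous.tendsto T).comp hlim).prodMk_nhds tendsto_const_nhds)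
  have e2 : Filter.Tendsto (fun n => inner A x (v n y)) Filter.atTop
      (nhds (inner A x (S y))) :=
    ((CStarModule.continuous_inner (A := A) (E := H)).tendsto (x, S y)).comp
      (tendsto_const_nhds.prodMk_nhds (((ContinuousLinearMap.apply ℂ H y).continuous.tendsto S).comp hS))
  refine tendsto_nhds_unique e1 (e2.congr fun n => (hv n x y).symm)

instance [CompleteSpace H] : CompleteSpace (Adjointable A H) :=
  (isClosed_adjointable (A := A) (H := H)).completeSpace_coe

/-- `𝓛(H)` is a `C⋆`-algebra for the operator norm, composition and the adjoint. -/
noncomputable instance [CompleteSpace H] : CStarAlgebra (Adjointable A H) where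

end AdjointableOperators

section QuasiProjectionPairs

variable {A H : Type*} [NonUnitalCStarAlgebra A] [PartialOrder A] [StarOrderedRing A]
  [NormedAddCommGroup H] [NormedSpace ℂ H] [SMul A H] [CStarModule A H]

/-- The range `𝓡(T)` of an adjointable operator. -/
noncomputable def opRange (T : Adjointable A H) : Submodule ℂ H :=
  LinearMap.range ((T : H →L[ℂ] H) : H →ₗ[ℂ] H)

/-- The norm closure of the range of an adjointable operator. -/
noncomputable def rangeClosure (T : Adjointable A H) : Submodule ℂ H :=
  (opRange T).topologicalClosure

/-- `M^⊥ = {x | ⟨x, y⟩ = 0 for every y ∈ M}`, for the `A`-valued inner product. -/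
def orthoCompl (A : Type*) {H : Type*} [NonUnitalCStarAlgebra A] [PartialOrder A]
    [StarOrderedRing A] [NormedAddCommGroup H] [NormedSpace ℂ H] [SMul A H] [CStarModule A H]
    (M : Submodule ℂ H) : Submodule ℂ H where
  carrier := {x | ∀ y ∈ M, inner A x y = 0}
  zero_mem' := fun y _ => by simp
  add_mem' := fun {x x'} hx hx' y hy => by
    rw [CStarModule.inner_add_left, hx y hy, hx' y hy, add_zero]
  smul_mem' := fun c x hx y hy => by
    rw [CStarModule.inner_smul_left_complex, hx y hy, smul_zero]

/-- `M` is orthogonally complemented in `H`: `M` is closed and `H = M + M^⊥`. -/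
def IsOrthoComplemented (A : Type*) {H : Type*} [NonUnitalCStarAlgebra A] [PartialOrder A]
    [StarOrderedRing A] [NormedAddCommGroup H] [NormedSpace ℂ H] [SMul A H] [CStarModule A H]
    (M : Submodule ℂ H) : Prop :=
  IsClosed (M : Set H) ∧ M ⊔ orthoCompl A M = ⊤

/-- `E = P_M`: the adjointable operator `E` is the projection of `H` onto `M`. -/
def IsProjectionOnto (E : Adjointable A H) (M : Submodule ℂ H) : Prop :=
  IsStarProjection E ∧ opRange E = M

/-- `|T|`, the square root of `T* T` in the `C⋆`-algebra `𝓛(H)`. -/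
noncomputable def opAbs [CompleteSpace H] (T : Adjointable A H) : Adjointable A H :=
  letI : PartialOrder (Adjointable A H) := CStarAlgebra.spectralOrder _
  letI : StarOrderedRing (Adjointable A H) := CStarAlgebra.spectralOrderedRing _
  CFC.abs T

/-- `T` has the polar decomposition: there is a partial isometry `U` in `𝓛(H)` with `T = U |T|`,
where `U* U` is the projection onto the closure of `𝓡(T*)`. -/
def HasPolarDecomposition [CompleteSpace H] (T : Adjointable A H) : Prop :=
  ∃ U : Adjointable A H, U * star U * U = U ∧ T = U * opAbs T ∧
    IsProjectionOnto (star U * U) (rangeClosure (star T))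

/-- `(P, Q)` is a quasi-projection pair: `P` is a projection, `Q` is an idempotent, and
`P Q* P = P Q P`, `P Q* (I - P) = - P Q (I - P)`, `(I - P) Q* (I - P) = (I - P) Q (I - P)`. -/
structure IsQuasiProjectionPair (P Q : Adjointable A H) : Prop where
  isStarProjection : IsStarProjection P
  isIdempotentElem : IsIdempotentElem Q
  corner_left : P * star Q * P = P * Q * P
  off_diagonal : P * star Q * (1 - P) = -(P * Q * (1 - P))
  corner_right : (1 - P) * star Q * (1 - P) = (1 - P) * Q * (1 - P)

/-- A quasi-projection pair `(P, Q)` is semi-harmonious if `P (I - Q)` and `(I - P) Q` both have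
the polar decomposition. -/
structure IsSemiHarmonious [CompleteSpace H] (P Q : Adjointable A H) : Prop where
  isQuasiProjectionPair : IsQuasiProjectionPair P Q
  polar_left : HasPolarDecomposition (P * (1 - Q))
  polar_right : HasPolarDecomposition ((1 - P) * Q)

/-- A quasi-projection pair `(P, Q)` is harmonious if the closures of the ranges of `P Q (I - P)`
and `(I - P) Q P` are both orthogonally complemented. -/
structure IsHarmonious (P Q : Adjointable A H) : Prop where
  isQuasiProjectionPair : IsQuasiProjectionPair P Q
  complemented_left : IsOrthoComplemented A (rangeClosure (P * Q * (1 - P)))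
  complemented_right : IsOrthoComplemented A (rangeClosure ((1 - P) * Q * P))

end QuasiProjectionPairs

/-! ### Invertibility and bounded approximate inverses in a C*-algebra. -/

section CStarApproximation

variable {B : Type*} [CStarAlgebra B]

/-! Let a, b, c, d be the corners PQP, PQ(1-P), (1-P)QP, (1-P)Q(1-P). The defining relations say
that a and d are self-adjoint and c = -b*; then Q² = Q gives bb* = a² - a = -(P - a)a. As T and TT*
have the same range closure (`rangeClosure_mul_star`), b and (P - a)a share theirs. Likewise P(1-Q)
times its adjoint is (P - a)(1 - 2a), where 1 - 2a is invertible because (1 - 2a)² = 1 + 4bb*. So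
P(1-Q) has the range closure of P - a and, replacing Q by 1-Q, PQ has that of a.

If both pairs are semi-harmonious, the commuting self-adjoint operators P - a and a have
complemented range closures, hence so does their product (`isOrthoComplemented_rangeClosure_mul`).
This settles b, and exchanging P with 1-P settles c.

Conversely, T has the polar decomposition once the range closures of T and T* are complemented
(`hasPolarDecomposition_of_isOrthoComplemented`). Ranges of idempotents are complemented, so each
closure is exhibited as such a range. Let G, G' be the projections onto the range closures of b and
c. Off G the product (P - a)a vanishes, so P - a is idempotent there, and G + (P - a)(1 - G) handles
P(1-Q). For its adjoint (1-Q*)P, the projection K = G + G' reduces Q (`IsQuasiPair.reduction`): on K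
the idempotent 1-Q* is used, and off K, where b and c vanish, (1-Q*)P is the idempotent P - a. The
other operators follow by the symmetries P ↔ 1-P and Q ↔ 1-Q. -/

theorem isUnit_one_add_star_mul_self (y : B) : IsUnit (1 + star y * y) := by
  let : PartialOrder B := CStarAlgebra.spectralOrder _
  let : StarOrderedRing B := CStarAlgebra.spectralOrderedRing _
  refine CStarAlgebra.isUnit_of_le (1 : B) ?_ isStrictlyPositive_one
  exact le_add_of_nonneg_right (star_mul_self_nonneg y)

/-- (1 + y)(1 - y) = 1 - y² = 1 + y*y is invertible, and the two factors commute. -/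
theorem isUnit_one_add_of_star_eq_neg {y : B} (hy : star y = -y) : IsUnit (1 + y) := by
  have h : Commute (1 + y) (1 - y) := by
    simp only [Commute, SemiconjBy]; noncomm_ring
  refine (h.isUnit_mul_iff.1 ?_).1
  have h2 := isUnit_one_add_star_mul_self y
  rw [hy] at h2
  convert h2 using 1
  noncomm_ring

/-- A bounded approximate inverse of `y ^ 2` for a self-adjoint element `y`. -/
theorem exists_approx_inv_sq {y : B} (hy : IsSelfAdjoint y) {δ : ℝ} (hδ : 0 < δ) :
    ∃ m : B, IsSelfAdjoint m ∧ Commute m y ∧ ‖y * (m * y)‖ ≤ 1 ∧ ‖1 - m * y * y‖ ≤ 1 ∧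
      ‖y * (1 - m * y * y)‖ ≤ δ := by
  have hpos : ∀ t : ℝ, 0 < t ^ 2 + δ ^ 2 := fun t => by positivity
  have hc : Continuous fun t : ℝ => (t ^ 2 + δ ^ 2)⁻¹ :=
    Continuous.inv₀ (by fun_prop) fun t => (hpos t).ne'
  -- A regularised t⁻²: then t·f·t ≤ 1, while 1 - f·t² = δ²/(t² + δ²) is at most 1 and stays below δ
  -- after multiplication by |t|.
  set f : ℝ → ℝ := fun t => (t ^ 2 + δ ^ 2)⁻¹ with hf
  have e1 : cfc (fun t => f t * t) y = cfc f y * y := by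
    rw [cfc_mul f (fun t => t) y, cfc_id' ℝ y]
  have e2 : cfc (fun t => f t * t * t) y = cfc f y * y * y := by
    rw [cfc_mul (fun t => f t * t) (fun t => t) y, cfc_id' ℝ y, e1]
  have e3 : cfc (fun t => 1 - f t * t * t) y = 1 - cfc f y * y * y := by
    rw [cfc_sub (fun _ => (1 : ℝ)) (fun t => f t * t * t) y, cfc_const_one ℝ y, e2]
  have e4 : cfc (fun t => t * (f t * t)) y = y * (cfc f y * y) := by
    rw [cfc_mul (fun t => t) (fun t => f t * t) y, cfc_id' ℝ y, e1]
  have e5 : cfc (fun t => t * (1 - f t * t * t)) y = y * (1 - cfc f y * y * y) := by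
    rw [cfc_mul (fun t => t) (fun t => 1 - f t * t * t) y, cfc_id' ℝ y, e3]
  have s1 : ∀ t, 1 - f t * t * t = δ ^ 2 / (t ^ 2 + δ ^ 2) := fun t => by
    have := (hpos t).ne'
    simp only [hf]; field_simp; ring
  refine ⟨cfc f y, cfc_predicate f y, ?_, ?_, ?_, ?_⟩
  · simpa [cfc_id ℝ y] using cfc_commute_cfc f id y
  · rw [← e4]
    refine norm_cfc_le zero_le_one fun t _ => ?_
    have : t * (f t * t) = t ^ 2 / (t ^ 2 + δ ^ 2) := by simp only [hf]; ring
    rw [this, Real.norm_of_nonneg (by positivity), div_le_one (hpos t)]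
    nlinarith [sq_nonneg δ]
  · rw [← e3]
    refine norm_cfc_le zero_le_one fun t _ => ?_
    rw [s1, Real.norm_of_nonneg (by positivity), div_le_one (hpos t)]
    nlinarith [sq_nonneg t]
  · rw [← e5]
    refine norm_cfc_le hδ.le fun t _ => ?_
    rw [s1, norm_mul, Real.norm_of_nonneg (by positivity : 0 ≤ δ ^ 2 / (t ^ 2 + δ ^ 2)),
      Real.norm_eq_abs, mul_div_assoc', div_le_iff₀ (hpos t)]
    nlinarith [sq_abs t, sq_nonneg (|t| - δ), mul_nonneg (abs_nonneg t) hδ.le]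

theorem norm_mul_eq_of_star_mul_self_eq {T X : B} (h : star T * T = star X * X) (Y : B) :
    ‖T * Y‖ = ‖X * Y‖ := by
  have : ‖T * Y‖ * ‖T * Y‖ = ‖X * Y‖ * ‖X * Y‖ := by
    rw [← CStarRing.norm_star_mul_self, ← CStarRing.norm_star_mul_self, star_mul, star_mul,
      mul_assoc, ← mul_assoc (star T), h]
    simp only [mul_assoc]
  exact (mul_self_inj (norm_nonneg _) (norm_nonneg _)).1 this

end CStarApproximation

/-! ### Orthogonal complements, projections and range closures. -/

section Complements

variable {A H : Type*} [NonUnitalCStarAlgebra A] [PartialOrder A] [StarOrderedRing A]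
  [NormedAddCommGroup H] [NormedSpace ℂ H] [SMul A H] [CStarModule A H]

theorem Adjointable.mul_apply (S T : Adjointable A H) (x : H) :
    ((S * T : Adjointable A H) : H →L[ℂ] H) x = (S : H →L[ℂ] H) ((T : H →L[ℂ] H) x) := rfl

theorem Adjointable.ext_apply {S T : Adjointable A H}
    (h : ∀ x, (S : H →L[ℂ] H) x = (T : H →L[ℂ] H) x) : S = T :=
  Subtype.ext (ContinuousLinearMap.ext h)

theorem inner_apply_left (T : Adjointable A H) (x y : H) :
    inner A ((T : H →L[ℂ] H) x) y = inner A x (((star T : Adjointable A H) : H →L[ℂ] H) y) :=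
  isAdjointOf_star T x y

theorem apply_mem_opRange (T : Adjointable A H) (x : H) : (T : H →L[ℂ] H) x ∈ opRange T :=
  ⟨x, rfl⟩

theorem opRange_le_rangeClosure (T : Adjointable A H) : opRange T ≤ rangeClosure T :=
  Submodule.le_topologicalClosure _

theorem isClosed_rangeClosure (T : Adjointable A H) : IsClosed (rangeClosure T : Set H) :=
  Submodule.isClosed_topologicalClosure _

theorem rangeClosure_le {T : Adjointable A H} {M : Submodule ℂ H} (hM : IsClosed (M : Set H))
    (h : ∀ x, (T : H →L[ℂ] H) x ∈ M) : rangeClosure T ≤ M :=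
  Submodule.topologicalClosure_minimal _ (by rintro _ ⟨x, rfl⟩; exact h x) hM

theorem rangeClosure_mul_le (S T : Adjointable A H) : rangeClosure (S * T) ≤ rangeClosure S :=
  rangeClosure_le (isClosed_rangeClosure S) fun _ =>
    opRange_le_rangeClosure S (apply_mem_opRange S _)

theorem rangeClosure_mul_isUnit (S : Adjointable A H) {u : Adjointable A H} (hu : IsUnit u) :
    rangeClosure (S * u) = rangeClosure S := by
  refine le_antisymm (rangeClosure_mul_le S u) ?_
  obtain ⟨v, hv⟩ := hu.exists_right_inv
  calc rangeClosure S = rangeClosure (S * u * v) := by rw [mul_assoc, hv, mul_one]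
    _ ≤ _ := rangeClosure_mul_le _ _

/-- If `S` maps the range of `T` into a closed subspace, it maps its closure there too. -/
theorem apply_mem_of_mem_rangeClosure {S T : Adjointable A H} {M : Submodule ℂ H}
    (hM : IsClosed (M : Set H)) (h : ∀ x, (S : H →L[ℂ] H) ((T : H →L[ℂ] H) x) ∈ M) {z : H}
    (hz : z ∈ rangeClosure T) : (S : H →L[ℂ] H) z ∈ M :=
  (rangeClosure_le (T := T)
    (M := M.comap ((S : H →L[ℂ] H) : H →ₗ[ℂ] H)) (hM.preimage (S : H →L[ℂ] H).continuous) h) hz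

theorem mem_opRange_iff {Z : Adjointable A H} (hZ : IsIdempotentElem Z) {x : H} :
    x ∈ opRange Z ↔ (Z : H →L[ℂ] H) x = x := by
  refine ⟨?_, fun h => ⟨x, h⟩⟩
  rintro ⟨y, rfl⟩
  exact congrArg (fun S : Adjointable A H => (S : H →L[ℂ] H) y) hZ.eq

theorem isClosed_opRange {Z : Adjointable A H} (hZ : IsIdempotentElem Z) :
    IsClosed (opRange Z : Set H) := by
  have : (opRange Z : Set H) = {x | (Z : H →L[ℂ] H) x = x} := Set.ext fun x => mem_opRange_iff hZ
  rw [this]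
  exact isClosed_eq (Z : H →L[ℂ] H).continuous continuous_id

/-- The range of an idempotent is orthogonally complemented. -/
theorem isOrthoComplemented_opRange [CompleteSpace H] {Z : Adjointable A H}
    (hZ : IsIdempotentElem Z) : IsOrthoComplemented A (opRange Z) := by
  refine ⟨isClosed_opRange hZ, eq_top_iff.2 fun x _ => ?_⟩
  -- Z - Z* is skew-adjoint. Solving (1 + Z - Z*)y = x splits x as Zy + (1 - Z*)y, whose second term
  -- is orthogonal to the range of Z because (1 - Z)Z = 0.
  have hu : IsUnit (1 + (Z - star Z)) := isUnit_one_add_of_star_eq_neg (by simp)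
  obtain ⟨v, hv⟩ := hu.exists_right_inv
  obtain ⟨y, hy⟩ : ∃ y, y = (v : H →L[ℂ] H) x := ⟨_, rfl⟩
  have hx : x = (Z : H →L[ℂ] H) y + ((1 - star Z : Adjointable A H) : H →L[ℂ] H) y := by
    have h1 : 1 + (Z - star Z) = Z + (1 - star Z) := by abel
    calc x = (((1 + (Z - star Z)) * v : Adjointable A H) : H →L[ℂ] H) x := by rw [hv]; rfl
      _ = _ := by rw [h1, hy]; rfl
  rw [hx]
  refine Submodule.add_mem_sup (apply_mem_opRange Z y) ?_
  rintro _ ⟨z, rfl⟩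
  have h2 : star (1 - star Z) * Z = 0 := by simp [sub_mul, hZ.eq]
  calc inner A (((1 - star Z : Adjointable A H) : H →L[ℂ] H) y) ((Z : H →L[ℂ] H) z)
      = inner A y (((star (1 - star Z) * Z : Adjointable A H) : H →L[ℂ] H) z) :=
        inner_apply_left _ _ _
    _ = 0 := by rw [h2]; simp

/-- An orthogonally complemented submodule is the range of a projection. -/
theorem IsOrthoComplemented.exists_isProjectionOnto {M : Submodule ℂ H}
    (hM : IsOrthoComplemented A M) : ∃ E : Adjointable A H, IsProjectionOnto E M := by
  have hd : ∀ x : H, ∃ z ∈ M, ∃ w ∈ orthoCompl A M, z + w = x := fun x =>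
    Submodule.mem_sup.1 (hM.2 ▸ Submodule.mem_top)
  choose e he w hw hx using hd
  have huniq : ∀ {x z : H}, z ∈ M → x - z ∈ orthoCompl A M → e x = z := fun {x z} hz hxz => by
    have h1 : e x - z ∈ M := M.sub_mem (he x) hz
    have h2 : e x - z ∈ orthoCompl A M := by
      rw [eq_sub_of_add_eq (hx x), sub_right_comm]
      exact Submodule.sub_mem _ hxz (hw x)
    have h3 := h2 _ h1
    rw [CStarModule.inner_self] at h3
    exact sub_eq_zero.1 h3
  have hsub : ∀ x, x - e x ∈ orthoCompl A M := fun x => by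
    have : x - e x = w x := by rw [sub_eq_iff_eq_add', hx]
    rw [this]; exact hw x
  let L : H →ₗ[ℂ] H :=
    { toFun := e
      map_add' := fun x y => huniq (M.add_mem (he x) (he y)) (by
        rw [add_sub_add_comm]; exact Submodule.add_mem _ (hsub x) (hsub y))
      map_smul' := fun c x => huniq (M.smul_mem c (he x)) (by
        simp only [RingHom.id_apply]
        rw [← smul_sub]; exact Submodule.smul_mem _ c (hsub x)) }
  have hself : ∀ x y, inner A (e x) (e y) = inner A (e x) y := fun x y => by
    have := hsub y _ (he x)
    rw [← CStarModule.star_inner, star_eq_zero, CStarModule.inner_sub_right, sub_eq_zero] at this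
    exact this.symm
  have hself' : ∀ x y, inner A (e x) (e y) = inner A x (e y) := fun x y => by
    rw [← CStarModule.star_inner, hself, CStarModule.star_inner]
  have hb : ∀ x, ‖L x‖ ≤ 1 * ‖x‖ := fun x => by
    have h1 : ‖e x‖ ^ 2 ≤ ‖e x‖ * ‖x‖ := by
      rw [CStarModule.norm_sq_eq A, hself]
      exact CStarModule.norm_inner_le H
    change ‖e x‖ ≤ _
    rcases (norm_nonneg (e x)).eq_or_lt with h0 | h0
    · rw [← h0]; positivity
    · rw [sq] at h1
      rw [one_mul]
      exact le_of_mul_le_mul_left h1 h0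
  let E' : H →L[ℂ] H := L.mkContinuous 1 hb
  have hadj : IsAdjointOf A E' E' := fun x y => (hself x y).symm.trans (hself' x y)
  have hfix : ∀ {z}, z ∈ M → e z = z := fun {z} hz => huniq hz (by simp)
  refine ⟨⟨E', E', hadj⟩, ⟨?_, adjointable_star_eq_of hadj⟩, ?_⟩
  · exact Adjointable.ext_apply fun x => hfix (he x)
  · ext z
    exact ⟨fun ⟨x, hxz⟩ => hxz ▸ he x, fun hz => ⟨z, hfix hz⟩⟩

theorem IsProjectionOnto.apply_eq {E : Adjointable A H} {M : Submodule ℂ H}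
    (hE : IsProjectionOnto E M) {x : H} (hx : x ∈ M) : (E : H →L[ℂ] H) x = x :=
  (mem_opRange_iff hE.1.isIdempotentElem).1 (hE.2 ▸ hx)

theorem IsProjectionOnto.apply_mem {E : Adjointable A H} {M : Submodule ℂ H}
    (hE : IsProjectionOnto E M) (x : H) : (E : H →L[ℂ] H) x ∈ M :=
  hE.2 ▸ apply_mem_opRange E x

theorem IsProjectionOnto.mul_eq {E X : Adjointable A H} (hE : IsProjectionOnto E (rangeClosure X)) :
    E * X = X :=
  Adjointable.ext_apply fun x =>
    hE.apply_eq (opRange_le_rangeClosure X (apply_mem_opRange X x))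

/-- A self-adjoint operator commuting with `X` commutes with the projection onto the closure of
the range of `X`. -/
theorem IsProjectionOnto.commute {E S X : Adjointable A H}
    (hE : IsProjectionOnto E (rangeClosure X)) (hS : IsSelfAdjoint S) (hSX : Commute S X) :
    Commute S E := by
  have h1 : E * (S * E) = S * E := Adjointable.ext_apply fun x => by
    refine hE.apply_eq (apply_mem_of_mem_rangeClosure (S := S) (isClosed_rangeClosure X)
      (fun y => ?_) (hE.apply_mem x))
    rw [← Adjointable.mul_apply, hSX.eq]
    exact opRange_le_rangeClosure X (apply_mem_opRange X _)
  have h2 := congrArg star h1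
  simp only [star_mul, hE.1.isSelfAdjoint.star_eq, hS.star_eq] at h2
  rw [Commute, SemiconjBy, ← h1, ← h2, mul_assoc]

/-- The two conditions are the two inclusions identifying the range closure with the range of Z.
Since Z need not be self-adjoint, algebraic idempotents suffice as witnesses of complementation. -/
theorem isOrthoComplemented_of_isIdempotentElem [CompleteSpace H] {Z X : Adjointable A H}
    (hZ : IsIdempotentElem Z) (h1 : Z * X = X)
    (h2 : ∀ x, (Z : H →L[ℂ] H) x ∈ rangeClosure X) :
    IsOrthoComplemented A (rangeClosure X) := by
  have : rangeClosure X = opRange Z := by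
    refine le_antisymm (rangeClosure_le (isClosed_opRange hZ) fun x => ?_) ?_
    · rw [← h1]; exact apply_mem_opRange Z _
    · rintro _ ⟨x, rfl⟩; exact h2 x
  rw [this]
  exact isOrthoComplemented_opRange hZ

/-- If two commuting self-adjoint operators have complemented range closures, so has their
product. -/
theorem isOrthoComplemented_rangeClosure_mul [CompleteSpace H] {X Y : Adjointable A H}
    (hX : IsSelfAdjoint X) (hY : IsSelfAdjoint Y) (hXY : Commute X Y)
    (hcX : IsOrthoComplemented A (rangeClosure X)) (hcY : IsOrthoComplemented A (rangeClosure Y)) :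
    IsOrthoComplemented A (rangeClosure (X * Y)) := by
  obtain ⟨E, hE⟩ := hcX.exists_isProjectionOnto
  obtain ⟨F, hF⟩ := hcY.exists_isProjectionOnto
  have hXF : Commute X F := hF.commute hX hXY
  have hYE : Commute Y E := hE.commute hY hXY.symm
  have hFE : Commute F E := hE.commute hF.1.isSelfAdjoint hXF.symm
  refine isOrthoComplemented_of_isIdempotentElem (Z := E * F) ?_ ?_ fun x => ?_
  · exact hE.1.isIdempotentElem.mul_of_commute hFE.symm hF.1.isIdempotentElem
  · rw [mul_assoc, ← mul_assoc F, ← hXF.eq, mul_assoc X, hF.mul_eq, ← mul_assoc, hE.mul_eq]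
  -- Two density arguments: Fx is a limit of vectors Yy, and E(Yy) = Y(Ey) with Ey a limit of
  -- vectors in the range of X.
  · refine apply_mem_of_mem_rangeClosure (S := E) (isClosed_rangeClosure _) (fun y => ?_)
      (hF.apply_mem x)
    rw [← Adjointable.mul_apply, ← hYE.eq, Adjointable.mul_apply]
    refine apply_mem_of_mem_rangeClosure (S := Y) (isClosed_rangeClosure _) (fun y => ?_)
      (hE.apply_mem y)
    rw [← Adjointable.mul_apply, ← hXY.eq]
    exact opRange_le_rangeClosure _ (apply_mem_opRange _ _)

/-- The operators `T` and `T T*` have the same range closure. -/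
theorem rangeClosure_mul_star [CompleteSpace H] (T : Adjointable A H) :
    rangeClosure (T * star T) = rangeClosure T := by
  refine le_antisymm (rangeClosure_mul_le _ _)
    (rangeClosure_le (isClosed_rangeClosure _) fun x => ?_)
  refine Metric.mem_closure_iff.2 fun ε hε => ?_
  obtain ⟨y, hy⟩ : ∃ y, y = T * star T := ⟨_, rfl⟩
  have hys : IsSelfAdjoint y := hy ▸ IsSelfAdjoint.mul_star_self T
  rw [← hy]
  -- Squared because ‖rT‖² = ‖r(TT*)r‖ ≤ δ is what gets estimated; the +1 avoids dividing by zero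
  -- and makes the last inequality strict.
  set δ : ℝ := (ε / (‖x‖ + 1)) ^ 2 with hδ
  have hδ0 : 0 < δ := by positivity
  obtain ⟨m, hm, hmy, -, hb, hb'⟩ := exists_approx_inv_sq hys hδ0
  set r := 1 - m * y * y with hr
  have hrs : star r = r := by
    simp only [hr, star_sub, star_one, star_mul, hys.star_eq, hm.star_eq]
    rw [← hmy.eq, ← mul_assoc, ← hmy.eq]
  have hn : ‖r * T‖ ^ 2 ≤ δ := by
    rw [sq, ← CStarRing.norm_self_mul_star, star_mul, hrs]
    calc ‖r * T * (star T * r)‖ = ‖r * (y * r)‖ := by simp only [hy, mul_assoc]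
      _ ≤ ‖r‖ * ‖y * r‖ := norm_mul_le _ _
      _ ≤ 1 * δ := by gcongr
      _ = δ := one_mul δ
  have hn' : ‖r * T‖ ≤ ε / (‖x‖ + 1) := by
    refine le_of_sq_le_sq ?_ (by positivity)
    rwa [← hδ]
  have hyr : T - y * (m * y * T) = r * T := by
    rw [hr, sub_mul, one_mul, hmy.eq]
    simp only [mul_assoc]
    rw [← mul_assoc m y T, hmy.eq, mul_assoc]
  refine ⟨_, apply_mem_opRange y (((m * y * T : Adjointable A H) : H →L[ℂ] H) x), ?_⟩
  rw [dist_eq_norm]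
  calc ‖(T : H →L[ℂ] H) x - (y : H →L[ℂ] H) (((m * y * T : Adjointable A H) : H →L[ℂ] H) x)‖
      = ‖((r * T : Adjointable A H) : H →L[ℂ] H) x‖ := by rw [← hyr]; rfl
    _ ≤ ‖r * T‖ * ‖x‖ := ((r * T : Adjointable A H) : H →L[ℂ] H).le_opNorm x
    _ ≤ ε / (‖x‖ + 1) * ‖x‖ := by gcongr
    _ < ε := by
      rw [div_mul_eq_mul_div, div_lt_iff₀ (by positivity)]
      nlinarith [norm_nonneg x]

end Complements

/-! ### Polar decomposition and complemented range closures. -/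

section PolarDecomposition

open Filter Topology

variable {A H : Type*} [NonUnitalCStarAlgebra A] [PartialOrder A] [StarOrderedRing A]
  [NormedAddCommGroup H] [NormedSpace ℂ H] [SMul A H] [CStarModule A H]

theorem isSelfAdjoint_opAbs [CompleteSpace H] (T : Adjointable A H) :
    IsSelfAdjoint (opAbs T) := by
  let : PartialOrder (Adjointable A H) := CStarAlgebra.spectralOrder _
  have : StarOrderedRing (Adjointable A H) := CStarAlgebra.spectralOrderedRing _
  exact IsSelfAdjoint.of_nonneg (CFC.abs_nonneg T)

theorem opAbs_mul_opAbs [CompleteSpace H] (T : Adjointable A H) :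
    opAbs T * opAbs T = star T * T := by
  let : PartialOrder (Adjointable A H) := CStarAlgebra.spectralOrder _
  have : StarOrderedRing (Adjointable A H) := CStarAlgebra.spectralOrderedRing _
  exact CFC.abs_mul_abs T

theorem rangeClosure_opAbs [CompleteSpace H] (T : Adjointable A H) :
    rangeClosure (opAbs T) = rangeClosure (star T) := by
  rw [← rangeClosure_mul_star (opAbs T), (isSelfAdjoint_opAbs T).star_eq, opAbs_mul_opAbs,
    ← rangeClosure_mul_star (star T), star_star]

theorem HasPolarDecomposition.isOrthoComplemented [CompleteSpace H] {T : Adjointable A H}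
    (hT : HasPolarDecomposition T) : IsOrthoComplemented A (rangeClosure T) := by
  obtain ⟨U, hU, hTU, hE⟩ := hT
  rw [← rangeClosure_opAbs] at hE
  refine isOrthoComplemented_of_isIdempotentElem (Z := U * star U) ?_ ?_ fun x => ?_
  · rw [IsIdempotentElem, ← mul_assoc, hU]
  · rw [hTU, ← mul_assoc, hU]
  -- Inserting U*U brings the vector into the closure of the range of |T|, which U maps into the
  -- range closure of T.
  · have h : U * star U = U * (star U * U * star U) := by
      rw [← mul_assoc, ← mul_assoc, hU]
    rw [h, Adjointable.mul_apply, Adjointable.mul_apply]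
    refine apply_mem_of_mem_rangeClosure (S := U) (isClosed_rangeClosure T) (fun y => ?_)
      (hE.apply_mem _)
    rw [← Adjointable.mul_apply, ← hTU]
    exact opRange_le_rangeClosure T (apply_mem_opRange T y)

/-- A bounded sequence of operators that converges pointwise on the range of `T` converges
pointwise on its closure. -/
theorem exists_tendsto_of_mem_rangeClosure [CompleteSpace H] {V : ℕ → Adjointable A H}
    (hV : ∀ n, ‖V n‖ ≤ 1) {T : Adjointable A H}
    (hT : ∀ x, ∃ l, Tendsto (fun n => (V n : H →L[ℂ] H) ((T : H →L[ℂ] H) x)) atTop (𝓝 l))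
    {z : H} (hz : z ∈ rangeClosure T) :
    ∃ l, Tendsto (fun n => (V n : H →L[ℂ] H) z) atTop (𝓝 l) := by
  refine cauchySeq_tendsto_of_complete (Metric.cauchySeq_iff.2 fun ε hε => ?_)
  obtain ⟨_, ⟨x, rfl⟩, hx⟩ := Metric.mem_closure_iff.1 hz (ε / 3) (by positivity)
  obtain ⟨l, hl⟩ := hT x
  obtain ⟨N, hN⟩ := Metric.cauchySeq_iff.1 hl.cauchySeq (ε / 3) (by positivity)
  have hb : ∀ n, dist ((V n : H →L[ℂ] H) z) ((V n : H →L[ℂ] H) ((T : H →L[ℂ] H) x)) < ε / 3 :=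
    fun n => by
      rw [dist_eq_norm, ← map_sub]
      refine lt_of_le_of_lt (((V n : H →L[ℂ] H).le_of_opNorm_le (hV n) _).trans_eq (one_mul _)) ?_
      rwa [← dist_eq_norm]
  refine ⟨N, fun m hm n hn => ?_⟩
  have h1 := dist_triangle4 ((V m : H →L[ℂ] H) z) ((V m : H →L[ℂ] H) ((T : H →L[ℂ] H) x))
    ((V n : H →L[ℂ] H) ((T : H →L[ℂ] H) x)) ((V n : H →L[ℂ] H) z)
  have h2 := hb m
  have h3 := hb n
  rw [dist_comm] at h3
  have h4 := hN m hm n hn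
  linarith

/-- A sequence of adjointable operators converging pointwise together with its adjoints has an
adjointable limit. -/
theorem exists_adjointable_limit [CompleteSpace H] {V : ℕ → Adjointable A H}
    (h : ∀ x, ∃ l, Tendsto (fun n => (V n : H →L[ℂ] H) x) atTop (𝓝 l))
    (h' : ∀ x, ∃ l, Tendsto (fun n => ((star (V n) : Adjointable A H) : H →L[ℂ] H) x) atTop
      (𝓝 l)) :
    ∃ U : Adjointable A H,
      (∀ x, Tendsto (fun n => (V n : H →L[ℂ] H) x) atTop (𝓝 ((U : H →L[ℂ] H) x))) ∧
      ∀ x, Tendsto (fun n => ((star (V n) : Adjointable A H) : H →L[ℂ] H) x) atTop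
        (𝓝 (((star U : Adjointable A H) : H →L[ℂ] H) x)) := by
  choose f hf using h
  choose g hg using h'
  let U : H →L[ℂ] H := continuousLinearMapOfTendsto (fun n => (V n : H →L[ℂ] H))
    (tendsto_pi_nhds.2 hf)
  let W : H →L[ℂ] H := continuousLinearMapOfTendsto
    (fun n => ((star (V n) : Adjointable A H) : H →L[ℂ] H)) (tendsto_pi_nhds.2 hg)
  have hadj : IsAdjointOf A U W := fun x y => by
    have e1 : Tendsto (fun n => inner A ((V n : H →L[ℂ] H) x) y) atTop (𝓝 (inner A (f x) y)) :=
      ((CStarModule.continuous_inner (A := A) (E := H)).tendsto (f x, y)).comp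
        ((hf x).prodMk_nhds tendsto_const_nhds)
    have e2 : Tendsto (fun n => inner A x (((star (V n) : Adjointable A H) : H →L[ℂ] H) y)) atTop
        (𝓝 (inner A x (g y))) :=
      ((CStarModule.continuous_inner (A := A) (E := H)).tendsto (x, g y)).comp
        (tendsto_const_nhds.prodMk_nhds (hg y))
    exact tendsto_nhds_unique e1 (e2.congr fun n => (inner_apply_left (V n) x y).symm)
  refine ⟨⟨U, W, hadj⟩, hf, ?_⟩
  rw [adjointable_star_eq_of (T := ⟨U, W, hadj⟩) (S := ⟨W, U, hadj.symm⟩) hadj]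
  exact hg

theorem IsOrthoComplemented.exists_add {M : Submodule ℂ H} (hM : IsOrthoComplemented A M) (x : H) :
    ∃ z ∈ M, ∃ w ∈ orthoCompl A M, z + w = x :=
  Submodule.mem_sup.1 (hM.2 ▸ Submodule.mem_top)

theorem star_apply_eq_zero {T : Adjointable A H} {w : H}
    (hw : w ∈ orthoCompl A (rangeClosure T)) :
    ((star T : Adjointable A H) : H →L[ℂ] H) w = 0 :=
  eq_of_inner_eq (A := A) fun z => by
    have h := hw _ (opRange_le_rangeClosure T (apply_mem_opRange T z))
    rw [← CStarModule.star_inner, star_eq_zero] at h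
    rw [← inner_apply_left, h, CStarModule.inner_zero_right]

theorem tendsto_apply_of_norm_sub_le {V : ℕ → Adjointable A H} {S T : Adjointable A H}
    (h : ∀ n : ℕ, ‖V n * S - T‖ ≤ 1 / ((n : ℝ) + 1)) (x : H) :
    Tendsto (fun n => (V n : H →L[ℂ] H) ((S : H →L[ℂ] H) x)) atTop (𝓝 ((T : H →L[ℂ] H) x)) := by
  have h0 : Tendsto (fun n => V n * S - T) atTop (𝓝 0) :=
    squeeze_zero_norm h tendsto_one_div_add_atTop_nhds_zero_nat
  have h1 : Tendsto (fun n => ((V n * S - T : Adjointable A H) : H →L[ℂ] H) x) atTop (𝓝 0) :=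
    ((ContinuousLinearMap.apply ℂ H x).continuous.comp continuous_subtype_val).tendsto' 0 0 (by simp)
      |>.comp h0
  have h2 := h1.add_const ((T : H →L[ℂ] H) x)
  rw [zero_add] at h2
  refine h2.congr fun n => ?_
  exact sub_add_cancel ((V n : H →L[ℂ] H) ((S : H →L[ℂ] H) x)) ((T : H →L[ℂ] H) x)

/-- An operator has the polar decomposition if the range closures of it and of its adjoint are
orthogonally complemented. -/
theorem hasPolarDecomposition_of_isOrthoComplemented [CompleteSpace H] {T : Adjointable A H}
    (h : IsOrthoComplemented A (rangeClosure T))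
    (h' : IsOrthoComplemented A (rangeClosure (star T))) : HasPolarDecomposition T := by
  obtain ⟨X, hX⟩ : ∃ X, X = opAbs T := ⟨_, rfl⟩
  have hXs : IsSelfAdjoint X := hX ▸ isSelfAdjoint_opAbs T
  have hXX : X * X = star T * T := hX ▸ opAbs_mul_opAbs T
  have hT' : rangeClosure (star T) = rangeClosure X := by rw [hX, rangeClosure_opAbs]
  unfold HasPolarDecomposition
  rw [← hX]
  rw [hT'] at h' ⊢
  have hnorm : ∀ Y, ‖T * Y‖ = ‖X * Y‖ :=
    norm_mul_eq_of_star_mul_self_eq (by rw [hXs.star_eq, hXX])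
  -- The partial isometry will be the pointwise limit of T·m_n·X, where m_n approximates X⁻². The
  -- bounds on X·m_n·X transfer to T because ‖TY‖ = ‖XY‖ for every Y.
  have hm := fun n : ℕ => exists_approx_inv_sq hXs (δ := 1 / ((n : ℝ) + 1)) (by positivity)
  choose m hms hmX hb1 hb2 hb3 using hm
  have hV1 : ∀ n, ‖T * (m n * X)‖ ≤ 1 := fun n => by rw [hnorm]; exact hb1 n
  have hV2 : ∀ n, ‖star (T * (m n * X))‖ ≤ 1 := fun n => by rw [norm_star]; exact hV1 n
  have hlim1 := tendsto_apply_of_norm_sub_le (V := fun n => T * (m n * X)) (S := X) (T := T)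
    fun n => by
      have e : T * (m n * X) * X - T = -(T * (1 - m n * X * X)) := by noncomm_ring
      rw [e, norm_neg, hnorm]; exact hb3 n
  have hstar : ∀ n, star (T * (m n * X)) = m n * X * star T := fun n => by
    rw [star_mul, star_mul, hXs.star_eq, (hms n).star_eq, (hmX n).eq]
  have hlim2 := tendsto_apply_of_norm_sub_le (V := fun n => star (T * (m n * X))) (S := T) (T := X)
    fun n => by
      have e : star (T * (m n * X)) * T - X = -(X * (1 - m n * X * X)) := by
        rw [hstar, mul_assoc, ← hXX, mul_sub, mul_one, (hmX n).eq, mul_assoc X, ← (hmX n).eq]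
        noncomm_ring
      rw [e, norm_neg]; exact hb3 n
  -- Convergence is known on the ranges of X and T, and by boundedness on their closures; on the
  -- orthogonal complements the approximants and their adjoints respectively vanish. This is where
  -- both complementation hypotheses enter.
  obtain ⟨U, hU, hU'⟩ := exists_adjointable_limit (V := fun n => T * (m n * X))
    (fun x => by
      obtain ⟨z, hz, w, hw, rfl⟩ := h'.exists_add x
      obtain ⟨l, hl⟩ := exists_tendsto_of_mem_rangeClosure hV1 (fun x => ⟨_, hlim1 x⟩) hz
      refine ⟨l, hl.congr fun n => ?_⟩
      have hw0 := star_apply_eq_zero hw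
      rw [hXs.star_eq] at hw0
      rw [map_add, Adjointable.mul_apply T, Adjointable.mul_apply T, Adjointable.mul_apply _ X w,
        hw0]
      simp)
    (fun x => by
      obtain ⟨z, hz, w, hw, rfl⟩ := h.exists_add x
      obtain ⟨l, hl⟩ := exists_tendsto_of_mem_rangeClosure hV2 (fun x => ⟨_, hlim2 x⟩) hz
      refine ⟨l, hl.congr fun n => ?_⟩
      rw [map_add, hstar, Adjointable.mul_apply _ (star T) w, star_apply_eq_zero hw]
      simp)
  have hUX : U * X = T := Adjointable.ext_apply fun x => tendsto_nhds_unique (hU _) (hlim1 x)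
  have hUT : star U * T = X := Adjointable.ext_apply fun x => tendsto_nhds_unique (hU' _) (hlim2 x)
  obtain ⟨E, hE⟩ := h'.exists_isProjectionOnto
  have hUE : U * E = U := Adjointable.ext_apply fun x => by
    obtain ⟨z, hz, w, hw, rfl⟩ := h'.exists_add x
    have hw0 := star_apply_eq_zero hw
    rw [hXs.star_eq] at hw0
    have hEw : (E : H →L[ℂ] H) w = 0 := by
      have := star_apply_eq_zero (T := E) (w := w) fun y hy => hw y (by
        rw [← hE.2]
        exact rangeClosure_le (isClosed_opRange hE.1.isIdempotentElem) (apply_mem_opRange E) hy)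
      rwa [hE.1.isSelfAdjoint.star_eq] at this
    have hUw : (U : H →L[ℂ] H) w = 0 := by
      refine tendsto_nhds_unique (hU w) (tendsto_const_nhds.congr fun n => ?_)
      rw [Adjointable.mul_apply T, Adjointable.mul_apply _ X w, hw0]
      simp
    rw [Adjointable.mul_apply, map_add, map_add, map_add, hE.apply_eq hz, hEw, hUw, map_zero]
  -- U*U fixes X, since U*UX = U*T = X, hence it fixes the closure of the range of X.
  have hUUE : star U * U * E = E := Adjointable.ext_apply fun x => by
    have h0 : (1 - star U * U) * X = 0 := by rw [sub_mul, one_mul, mul_assoc, hUX, hUT, sub_self]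
    have h1 : ((1 - star U * U : Adjointable A H) : H →L[ℂ] H) ((E : H →L[ℂ] H) x) ∈
        (⊥ : Submodule ℂ H) :=
      apply_mem_of_mem_rangeClosure (T := X) isClosed_singleton (fun y => by
        rw [← Adjointable.mul_apply, h0]; rfl) (hE.apply_mem x)
    exact (sub_eq_zero.1 ((Submodule.mem_bot ℂ).1 h1)).symm
  have hUU : star U * U = E := by rw [← hUUE, mul_assoc, hUE]
  exact ⟨U, by rw [mul_assoc, hUU, hUE], hUX.symm, hUU ▸ hE⟩

end PolarDecomposition

/-! ### Building idempotents in a ring. -/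

section Idempotents

variable {R : Type*} [Ring R]

/-- A completion of `e (1 - G)` to an idempotent. -/
theorem isIdempotentElem_add_mul_one_sub {e G : R} (hG : G * G = G) (heG : Commute e G)
    (he : e * e * (1 - G) = e * (1 - G)) :
    IsIdempotentElem (G + e * (1 - G)) ∧ (G + e * (1 - G)) * e = e := by
  have hG1 : G * (1 - G) = 0 := by rw [mul_sub, mul_one, hG, sub_self]
  have hG2 : (1 - G) * G = 0 := by rw [sub_mul, one_mul, hG, sub_self]
  have hG3 : (1 - G) * (1 - G) = 1 - G := by rw [sub_mul, one_mul, hG1, sub_zero]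
  have heG' : Commute e (1 - G) := (Commute.one_right e).sub_right heG
  constructor
  · have h1 : G * (e * (1 - G)) = 0 := by rw [heG'.eq, ← mul_assoc, hG1, zero_mul]
    have h2 : e * (1 - G) * (e * (1 - G)) = e * (1 - G) := by
      rw [mul_assoc e, ← mul_assoc (1 - G), ← heG'.eq, mul_assoc e (1 - G), hG3, ← mul_assoc, he]
    rw [IsIdempotentElem, add_mul, mul_add, mul_add, hG, h1, h2, mul_assoc, hG2, mul_zero,
      add_zero, zero_add]
  · rw [add_mul, mul_assoc, ← heG'.eq, ← mul_assoc, he, mul_sub, mul_one, heG.eq,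
      add_sub_cancel]

/-- Gluing two idempotents along a third one that commutes with them. -/
theorem isIdempotentElem_mul_add_mul {q e K P : R} (hq : q * q = q) (hK : K * K = K)
    (hqK : Commute q K) (heK : Commute e K) (hPK : Commute P K)
    (hqP : q * P * (1 - K) = e * (1 - K)) (he : e * e * (1 - K) = e * (1 - K)) :
    IsIdempotentElem (q * K + e * (1 - K)) ∧
      (q * K + e * (1 - K)) * (q * P) = q * P := by
  have hK1 : K * (1 - K) = 0 := by rw [mul_sub, mul_one, hK, sub_self]
  have hK2 : (1 - K) * K = 0 := by rw [sub_mul, one_mul, hK, sub_self]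
  have hK3 : (1 - K) * (1 - K) = 1 - K := by rw [sub_mul, one_mul, hK1, sub_zero]
  have heK' : Commute e (1 - K) := (Commute.one_right e).sub_right heK
  have hqK' : Commute q (1 - K) := (Commute.one_right q).sub_right hqK
  have hPK' : Commute P (1 - K) := (Commute.one_right P).sub_right hPK
  obtain ⟨Z, hZ⟩ : ∃ Z, Z = q * K + e * (1 - K) := ⟨_, rfl⟩
  rw [← hZ]
  have hZK : Z * K = q * K := by
    rw [hZ, add_mul, mul_assoc, hK, mul_assoc, hK2, mul_zero, add_zero]
  have hZK' : Z * (1 - K) = e * (1 - K) := by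
    rw [hZ, add_mul, mul_assoc, hK1, mul_assoc, hK3, mul_zero, zero_add]
  have hqKq : q * K * q = q * K := by rw [mul_assoc, ← hqK.eq, ← mul_assoc, hq]
  have h1 : Z * (q * K) = q * K := by rw [hqK.eq, ← mul_assoc, hZK, hqKq, hqK.eq]
  have h2 : Z * (e * (1 - K)) = e * (1 - K) := by
    rw [heK'.eq, ← mul_assoc, hZK', mul_assoc, ← heK'.eq, ← mul_assoc, he]
  constructor
  · rw [IsIdempotentElem]
    nth_rewrite 2 [hZ]
    rw [mul_add, h1, h2, ← hZ]
  · have h3 : q * P = q * K * P + e * (1 - K) := by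
      rw [← hqP, mul_assoc q K, ← hPK.eq, ← mul_assoc, ← mul_add, add_sub_cancel, mul_one]
    rw [h3, mul_add, ← mul_assoc, h1, h2]

end Idempotents

/-! ### Algebra of the corners of a quasi-projection pair. -/

section StarRing

variable {R : Type*} [Ring R] [StarRing R]

/-- The algebraic identities of a quasi-projection pair, in an arbitrary star ring. -/
structure IsQuasiPair (P Q : R) : Prop where
  star_left : star P = P
  mul_self_left : P * P = P
  mul_self_right : Q * Q = Q
  corner_left : P * star Q * P = P * Q * P
  off_diagonal : P * star Q * (1 - P) = -(P * Q * (1 - P))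
  corner_right : (1 - P) * star Q * (1 - P) = (1 - P) * Q * (1 - P)

namespace IsQuasiPair

variable {P Q : R}

theorem one_sub_left (h : IsQuasiPair P Q) : IsQuasiPair (1 - P) Q where
  star_left := by rw [star_sub, star_one, h.star_left]
  mul_self_left := (IsIdempotentElem.one_sub h.mul_self_left).eq
  mul_self_right := h.mul_self_right
  corner_left := h.corner_right
  off_diagonal := by
    have := congrArg star h.off_diagonal
    simp only [star_mul, star_neg, star_sub, star_one, star_star, h.star_left] at this
    rw [sub_sub_cancel, mul_assoc, mul_assoc, this, neg_neg]
  corner_right := by rw [sub_sub_cancel, h.corner_left]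

theorem one_sub_right (h : IsQuasiPair P Q) : IsQuasiPair P (1 - Q) where
  star_left := h.star_left
  mul_self_left := h.mul_self_left
  mul_self_right := (IsIdempotentElem.one_sub h.mul_self_right).eq
  corner_left := by
    simp only [star_sub, star_one, mul_sub, sub_mul, h.corner_left]
  off_diagonal := by
    have h0 : P * 1 * (1 - P) = 0 := by
      rw [mul_one, mul_sub, mul_one, h.mul_self_left, sub_self]
    rw [star_sub, star_one, mul_sub P, mul_sub P, sub_mul _ _ (1 - P), sub_mul _ _ (1 - P),
      h.off_diagonal, h0, zero_sub, zero_sub]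
  corner_right := by
    rw [star_sub, star_one, mul_sub (1 - P), mul_sub (1 - P), sub_mul _ _ (1 - P),
      sub_mul _ _ (1 - P), h.corner_right]

theorem star_lower (h : IsQuasiPair P Q) : star ((1 - P) * Q * P) = -(P * Q * (1 - P)) := by
  rw [← h.off_diagonal]
  simp only [star_mul, star_sub, star_one, h.star_left, mul_assoc]

theorem star_upper (h : IsQuasiPair P Q) : star (P * Q * (1 - P)) = -((1 - P) * Q * P) := by
  rw [← neg_inj, ← star_neg, ← h.star_lower, star_star, neg_neg]

theorem star_corner (h : IsQuasiPair P Q) : star (P * Q * P) = P * Q * P := by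
  rw [star_mul, star_mul, h.star_left, ← mul_assoc, h.corner_left]

/-- Compressing Q² = Q to the corner P gives a² + bc = a, and b* = -c. -/
theorem upper_mul_star (h : IsQuasiPair P Q) :
    P * Q * (1 - P) * star (P * Q * (1 - P)) = P * Q * P * (P * Q * P) - P * Q * P := by
  have h1 : (1 - P) * (1 - P) = 1 - P := (IsIdempotentElem.one_sub h.mul_self_left).eq
  have e : P * Q * (1 - P) * ((1 - P) * Q * P) = P * Q * P - P * Q * P * (P * Q * P) := by
    calc P * Q * (1 - P) * ((1 - P) * Q * P)
        = P * Q * ((1 - P) * (1 - P)) * (Q * P) := by simp only [mul_assoc]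
      _ = P * (Q * Q) * P - P * Q * P * (Q * P) := by rw [h1]; noncomm_ring
      _ = P * Q * P - P * Q * (P * P) * (Q * P) := by rw [h.mul_self_left, h.mul_self_right]
      _ = _ := by simp only [mul_assoc]
  rw [h.star_upper, mul_neg, e, neg_sub]

theorem mul_corner (h : IsQuasiPair P Q) : P * (P * Q * P) = P * Q * P := by
  rw [← mul_assoc, ← mul_assoc, h.mul_self_left]

theorem corner_mul (h : IsQuasiPair P Q) : P * Q * P * P = P * Q * P := by
  rw [mul_assoc, h.mul_self_left]

theorem commute_corner (h : IsQuasiPair P Q) : Commute P (P * Q * P) :=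
  h.mul_corner.trans h.corner_mul.symm

theorem upper_mul_star_eq (h : IsQuasiPair P Q) :
    P * Q * (1 - P) * star (P * Q * (1 - P)) = (P - P * Q * P) * (P * Q * P) * (-1) := by
  rw [h.upper_mul_star, sub_mul, h.mul_corner, mul_neg_one, neg_sub]

/-- Completing the square in 1 + 4(a² - a). The left side has the form 1 + y*y, so in a C*-algebra
this makes 1 - 2a invertible. -/
theorem one_add_four_upper_mul_star (h : IsQuasiPair P Q) :
    1 + star (2 * star (P * Q * (1 - P))) * (2 * star (P * Q * (1 - P))) =
      (1 - 2 * (P * Q * P)) * (1 - 2 * (P * Q * P)) := by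
  have : star (2 * star (P * Q * (1 - P))) * (2 * star (P * Q * (1 - P))) =
      4 * (P * Q * (1 - P) * star (P * Q * (1 - P))) := by
    generalize P * Q * (1 - P) = b
    rw [two_mul, star_add, star_star]; noncomm_ring
  rw [this, h.upper_mul_star]
  generalize P * Q * P = a
  noncomm_ring

/-- P(1-Q) = (P - a) - b, and the cross terms vanish since b ends in 1-P; what remains is (P - a)² +
bb*, with bb* = a² - a. -/
theorem mul_one_sub_mul_star (h : IsQuasiPair P Q) :
    P * (1 - Q) * star (P * (1 - Q)) = (P - P * Q * P) * (1 - 2 * (P * Q * P)) := by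
  have hab := h.upper_mul_star
  have haP := h.corner_mul
  have hPa := h.mul_corner
  have has := h.star_corner
  have hbP : P * Q * (1 - P) * P = 0 := by
    rw [mul_assoc, sub_mul, one_mul, h.mul_self_left, sub_self, mul_zero]
  have hT : P * (1 - Q) = P - P * Q * P - P * Q * (1 - P) := by noncomm_ring
  rw [hT]
  generalize P * Q * P = a at *
  generalize P * Q * (1 - P) = b at *
  have hP := h.mul_self_left
  have hPs := h.star_left
  have hba : b * a = 0 := by rw [← hPa, ← mul_assoc, hbP, zero_mul]
  have hPb : P * star b = 0 := by simpa [hPs] using congrArg star hbP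
  have hab' : a * star b = 0 := by simpa [has] using congrArg star hba
  have e1 : (P - a) * (1 - 2 * a) = P - a - P * a - P * a + a * a + a * a := by noncomm_ring
  rw [star_sub, star_sub, hPs, has, e1]
  simp only [sub_mul, mul_sub, hP, hPa, haP, hPb, hab', hbP, hba, hab]
  abel

end IsQuasiPair

end StarRing

/-! ### Range closures for P(1-Q) and the off-diagonal corners. -/

section QuasiProjectionPairs

variable {A H : Type*} [NonUnitalCStarAlgebra A] [PartialOrder A] [StarOrderedRing A]
  [NormedAddCommGroup H] [NormedSpace ℂ H] [SMul A H] [CStarModule A H]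

variable {P Q : Adjointable A H}

theorem IsQuasiProjectionPair.isQuasiPair (h : IsQuasiProjectionPair P Q) : IsQuasiPair P Q :=
  ⟨h.isStarProjection.isSelfAdjoint.star_eq, h.isStarProjection.isIdempotentElem.eq,
    h.isIdempotentElem.eq, h.corner_left, h.off_diagonal, h.corner_right⟩

theorem IsQuasiPair.isQuasiProjectionPair (h : IsQuasiPair P Q) : IsQuasiProjectionPair P Q :=
  ⟨⟨h.mul_self_left, h.star_left⟩, h.mul_self_right, h.corner_left, h.off_diagonal,
    h.corner_right⟩

theorem IsProjectionOnto.mul_eq_of_mul_eq {E X S : Adjointable A H}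
    (hE : IsProjectionOnto E (rangeClosure X)) (hS : S * S = S) (hSX : S * X = X) : S * E = E :=
  Adjointable.ext_apply fun x => by
    refine (mem_opRange_iff hS).1 (rangeClosure_le (isClosed_opRange hS) (fun y => ?_)
      (hE.apply_mem x))
    rw [← hSX]; exact apply_mem_opRange S _

namespace IsQuasiPair

theorem rangeClosure_upper [CompleteSpace H] (h : IsQuasiPair P Q) :
    rangeClosure (P * Q * (1 - P)) = rangeClosure ((P - P * Q * P) * (P * Q * P)) := by
  rw [← rangeClosure_mul_star, h.upper_mul_star_eq]
  exact rangeClosure_mul_isUnit _ isUnit_one.neg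

theorem rangeClosure_mul_one_sub [CompleteSpace H] (h : IsQuasiPair P Q) :
    rangeClosure (P * (1 - Q)) = rangeClosure (P - P * Q * P) := by
  have h1 := isUnit_one_add_star_mul_self (2 * star (P * Q * (1 - P)))
  have h2 : IsUnit ((1 - 2 * (P * Q * P)) * (1 - 2 * (P * Q * P))) :=
    h.one_add_four_upper_mul_star ▸ h1
  rw [← rangeClosure_mul_star, h.mul_one_sub_mul_star]
  exact rangeClosure_mul_isUnit _ ((Commute.refl (1 - 2 * (P * Q * P))).isUnit_mul_iff.1 h2).1

theorem isOrthoComplemented_upper [CompleteSpace H] (h : IsQuasiPair P Q)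
    (h1 : HasPolarDecomposition (P * (1 - Q))) (h2 : HasPolarDecomposition (P * Q)) :
    IsOrthoComplemented A (rangeClosure (P * Q * (1 - P))) := by
  have e1 := h1.isOrthoComplemented
  have e2 : IsOrthoComplemented A (rangeClosure (P * (1 - (1 - Q)))) := by
    rw [sub_sub_cancel]; exact h2.isOrthoComplemented
  rw [h.rangeClosure_mul_one_sub] at e1
  rw [h.one_sub_right.rangeClosure_mul_one_sub] at e2
  have e3 : P - P * (1 - Q) * P = P * Q * P := by
    rw [mul_sub, mul_one, sub_mul, h.mul_self_left, sub_sub_cancel]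
  rw [e3] at e2
  rw [h.rangeClosure_upper]
  exact isOrthoComplemented_rangeClosure_mul
    (IsSelfAdjoint.sub h.star_left h.star_corner) h.star_corner
    (h.commute_corner.sub_left (Commute.refl _)) e1 e2

theorem commute_corner_projection [CompleteSpace H] (h : IsQuasiPair P Q) {G : Adjointable A H}
    (hG : IsProjectionOnto G (rangeClosure (P * Q * (1 - P)))) : Commute (P * Q * P) G := by
  rw [h.rangeClosure_upper] at hG
  exact hG.commute h.star_corner
    ((h.commute_corner.symm.sub_right (Commute.refl _)).mul_right (Commute.refl _))

theorem isOrthoComplemented_mul_one_sub [CompleteSpace H] (h : IsQuasiPair P Q)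
    (h1 : IsOrthoComplemented A (rangeClosure (P * Q * (1 - P)))) :
    IsOrthoComplemented A (rangeClosure (P * (1 - Q))) := by
  obtain ⟨G, hG⟩ := h1.exists_isProjectionOnto
  have haG := h.commute_corner_projection hG
  have hPb : P * (P * Q * (1 - P)) = P * Q * (1 - P) := by
    rw [← mul_assoc, ← mul_assoc, h.mul_self_left]
  have hPG : P * G = G := hG.mul_eq_of_mul_eq h.mul_self_left hPb
  have hGP : G * P = G := by
    have := congrArg star hPG
    rwa [star_mul, hG.1.isSelfAdjoint.star_eq, h.star_left] at this
  have heG : Commute (P - P * Q * P) G :=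
    (show Commute P G from hPG.trans hGP.symm).sub_left haG
  -- G projects onto the range closure of (P - a)a and commutes with this product, so the product
  -- dies on 1 - G; hence (P - a)² and P - a agree there.
  have hx : (P - P * Q * P) * (P * Q * P) * (1 - G) = 0 := by
    rw [h.rangeClosure_upper] at hG
    have h3 := hG.mul_eq
    have h4 : Commute ((P - P * Q * P) * (P * Q * P)) G := heG.mul_left haG
    rw [mul_sub, mul_one, h4.eq, h3, sub_self]
  have he : (P - P * Q * P) * (P - P * Q * P) * (1 - G) = (P - P * Q * P) * (1 - G) := by
    have h2 : (P - P * Q * P) * P = P - P * Q * P := by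
      rw [sub_mul, h.mul_self_left, h.corner_mul]
    rw [mul_sub (P - P * Q * P) P, h2, sub_mul _ _ (1 - G), hx, sub_zero]
  obtain ⟨hi, hm⟩ := isIdempotentElem_add_mul_one_sub hG.1.isIdempotentElem.eq heG he
  rw [h.rangeClosure_mul_one_sub]
  refine isOrthoComplemented_of_isIdempotentElem hi hm fun x => ?_
  refine Submodule.add_mem _ ?_ (opRange_le_rangeClosure _ (apply_mem_opRange _ _))
  refine rangeClosure_mul_le _ (P * Q * P) ?_
  rw [← h.rangeClosure_upper]
  exact hG.apply_mem x

end IsQuasiPair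
end QuasiProjectionPairs

/-! ### Reduction by the supports of the off-diagonal corners. -/

section StarRing

variable {R : Type*} [Ring R] [StarRing R]

/-- The sum of the support projections of the off-diagonal corners of a quasi-projection pair
reduces it; outside it, the adjoint acts diagonally. -/
theorem IsQuasiPair.reduction {P Q G G' : R} (h : IsQuasiPair P Q)
    (hGs : star G = G) (hGs' : star G' = G') (hGG : G * G = G) (hGG' : G' * G' = G')
    (hPG : P * G = G) (hPG' : (1 - P) * G' = G')
    (hGb : G * (P * Q * (1 - P)) = P * Q * (1 - P))
    (hGc : G' * ((1 - P) * Q * P) = (1 - P) * Q * P)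
    (haG : Commute (P * Q * P) G) (hdG : Commute ((1 - P) * Q * (1 - P)) G') :
    ∃ Z, IsIdempotentElem Z ∧ Z * ((1 - star Q) * P) = (1 - star Q) * P ∧
      Z = (1 - star Q) * P * G + (1 - star Q) * G' + (1 - star Q) * P * (1 - (G + G')) ∧
      (1 - star Q) * ((1 - P) * Q * P) = (1 - star Q) * P * (star Q * P) := by
  obtain ⟨q, hq⟩ : ∃ q, q = 1 - star Q := ⟨_, rfl⟩
  have hqq : q * q = q := by
    have := congrArg star (IsIdempotentElem.one_sub h.mul_self_right).eq
    rwa [star_mul, star_sub, star_one, ← hq] at this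
  have hP := h.mul_self_left
  have hPs := h.star_left
  have has := h.star_corner
  have hds := h.one_sub_left.star_corner
  have hbs := h.star_upper
  have hcs := h.star_lower
  have haP := h.corner_mul
  have hPa := h.mul_corner
  have haa := h.upper_mul_star
  rw [hbs, mul_neg] at haa
  have hPP : P * (1 - P) = 0 := by rw [mul_sub, mul_one, hP, sub_self]
  have hPP' : (1 - P) * P = 0 := by rw [sub_mul, one_mul, hP, sub_self]
  have hPb : P * (P * Q * (1 - P)) = P * Q * (1 - P) := by rw [← mul_assoc, ← mul_assoc, hP]
  have hbP : P * Q * (1 - P) * P = 0 := by rw [mul_assoc, hPP', mul_zero]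
  have hcP : (1 - P) * Q * P * P = (1 - P) * Q * P := by rw [mul_assoc, hP]
  have hdP : (1 - P) * Q * (1 - P) * P = 0 := by rw [mul_assoc, hPP', mul_zero]
  have hPc : P * ((1 - P) * Q * P) = 0 := by
    rw [← mul_assoc, ← mul_assoc, hPP, zero_mul, zero_mul]
  have hPd : P * ((1 - P) * Q * (1 - P)) = 0 := by
    rw [← mul_assoc, ← mul_assoc, hPP, zero_mul, zero_mul]
  have hPG0 : P * G' = 0 := by rw [← hPG', ← mul_assoc, hPP, zero_mul]
  have hQ : Q = P * Q * P + P * Q * (1 - P) + (1 - P) * Q * P + (1 - P) * Q * (1 - P) := by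
    noncomm_ring
  -- Taking adjoints keeps the diagonal corners and flips the sign of the off-diagonal ones.
  have hQs : star Q =
      P * Q * P - P * Q * (1 - P) - (1 - P) * Q * P + (1 - P) * Q * (1 - P) := by
    conv_lhs => rw [hQ]
    rw [star_add, star_add, star_add, has, hbs, hcs, hds]; abel
  rw [← hq]
  generalize P * Q * P = a at *
  generalize P * Q * (1 - P) = b at *
  generalize (1 - P) * Q * P = c at *
  generalize (1 - P) * Q * (1 - P) = d at *
  clear hQ
  have hcG : c * G = c := by
    have := congrArg star hGb
    rwa [star_mul, hGs, hbs, neg_mul, neg_inj] at this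
  have hbG' : b * G' = b := by
    have := congrArg star hGc
    rwa [star_mul, hGs', hcs, neg_mul, neg_inj] at this
  have hGP : G * P = G := by simpa [hPs, hGs] using congrArg star hPG
  have hGP0 : G' * P = 0 := by simpa [hPs, hGs'] using congrArg star hPG0
  have hGG0 : G * G' = 0 := by rw [← hGP, mul_assoc, hPG0, mul_zero]
  have hGG0' : G' * G = 0 := by rw [← hPG, ← mul_assoc, hGP0, zero_mul]
  obtain ⟨K, hK⟩ : ∃ K, K = G + G' := ⟨_, rfl⟩
  have hKK : K * K = K := by
    rw [hK, add_mul, mul_add, mul_add, hGG, hGG', hGG0, hGG0', add_zero, zero_add]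
  have hPK : Commute P K := by
    rw [Commute, SemiconjBy, hK, mul_add, add_mul, hPG, hGP, hPG0, hGP0]
  have hbK : b * K = b := by
    have : b * G = 0 := by rw [← hPG, ← mul_assoc, hbP, zero_mul]
    rw [hK, mul_add, this, hbG', zero_add]
  have hKb : K * b = b := by
    have : G' * b = 0 := by rw [← hPb, ← mul_assoc, hGP0, zero_mul]
    rw [hK, add_mul, this, hGb, add_zero]
  have hcK : c * K = c := by
    have : c * G' = 0 := by rw [← hcP, mul_assoc, hPG0, mul_zero]
    rw [hK, mul_add, this, hcG, add_zero]
  have hKc : K * c = c := by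
    have : G * c = 0 := by rw [← hGP, mul_assoc, hPc, mul_zero]
    rw [hK, add_mul, this, hGc, zero_add]
  have haK : Commute a K := by
    have h1 : a * G' = 0 := by rw [← haP, mul_assoc, hPG0, mul_zero]
    have h2 : G' * a = 0 := by rw [← hPa, ← mul_assoc, hGP0, zero_mul]
    rw [Commute, SemiconjBy, hK, mul_add, add_mul, h1, h2, haG.eq]
  have hdK : Commute d K := by
    have h1 : d * G = 0 := by rw [← hPG, ← mul_assoc, hdP, zero_mul]
    have h2 : G * d = 0 := by rw [← hGP, mul_assoc, hPd, mul_zero]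
    rw [Commute, SemiconjBy, hK, mul_add, add_mul, h1, h2, hdG.eq]
  have hqK : Commute q K := by
    have h1 : Commute b K := hbK.trans hKb.symm
    have h2 : Commute c K := hcK.trans hKc.symm
    rw [hq, hQs]
    exact (Commute.one_left K).sub_left (((haK.sub_left h1).sub_left h2).add_left hdK)
  have hQP : star Q * P = a - c := by
    rw [hQs]
    simp only [sub_mul, add_mul, haP, hbP, hcP, hdP]
    abel
  obtain ⟨e, he⟩ : ∃ e, e = P - a := ⟨_, rfl⟩
  have heK : Commute e K := he ▸ hPK.sub_left haK
  have hqP : q * P * (1 - K) = e * (1 - K) := by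
    have h1 : q * P = e + c := by rw [hq, sub_mul, one_mul, hQP, he]; abel
    rw [h1, add_mul, mul_sub c, mul_one, hcK, sub_self, add_zero]
  have hee : e * e * (1 - K) = e * (1 - K) := by
    -- The defect bc of idempotency is killed by 1 - K because cK = c.
    have h1 : e * e = e - b * c := by
      rw [he]
      simp only [sub_mul, mul_sub, hP, haP, hPa, eq_add_of_sub_eq haa.symm]
      abel
    rw [h1, sub_mul, mul_assoc b, mul_sub c, mul_one, hcK, sub_self, mul_zero, sub_zero]
  obtain ⟨hi, hm⟩ := isIdempotentElem_mul_add_mul hqq hKK hqK heK hPK hqP hee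
  refine ⟨_, hi, hm, ?_, ?_⟩
  · rw [← hK, hqP, mul_assoc q P, hPG, hK, mul_add]
  -- From qQ* = 0 and Q*P = a - c follows qc = qa, so q sends the range of c into that of qP.
  · have h2 : q * star Q = 0 := by
      rw [show star Q = 1 - q by rw [hq, sub_sub_cancel], mul_sub, mul_one, hqq, sub_self]
    have h3 : q * (a - c) = 0 := by rw [← hQP, ← mul_assoc, h2, zero_mul]
    rw [hQP, mul_assoc, mul_sub P, hPa, hPc, sub_zero]
    rw [mul_sub, sub_eq_zero] at h3
    exact h3.symm

end StarRing

/-! ### From complemented corners to polar decompositions. -/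

section QuasiProjectionPairs

variable {A H : Type*} [NonUnitalCStarAlgebra A] [PartialOrder A] [StarOrderedRing A]
  [NormedAddCommGroup H] [NormedSpace ℂ H] [SMul A H] [CStarModule A H]

variable {P Q : Adjointable A H}

namespace IsQuasiPair

theorem isOrthoComplemented_star_mul_one_sub [CompleteSpace H] (h : IsQuasiPair P Q)
    (h1 : IsOrthoComplemented A (rangeClosure (P * Q * (1 - P))))
    (h2 : IsOrthoComplemented A (rangeClosure ((1 - P) * Q * P))) :
    IsOrthoComplemented A (rangeClosure (star (P * (1 - Q)))) := by
  obtain ⟨G, hG⟩ := h1.exists_isProjectionOnto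
  obtain ⟨G', hG'⟩ := h2.exists_isProjectionOnto
  have hPb : P * (P * Q * (1 - P)) = P * Q * (1 - P) := by
    rw [← mul_assoc, ← mul_assoc, h.mul_self_left]
  have hPc : (1 - P) * ((1 - P) * Q * P) = (1 - P) * Q * P := by
    rw [← mul_assoc, ← mul_assoc, h.one_sub_left.mul_self_left]
  obtain ⟨Z, hZi, hZm, hZ, hc⟩ := h.reduction hG.1.isSelfAdjoint.star_eq
    hG'.1.isSelfAdjoint.star_eq hG.1.isIdempotentElem.eq hG'.1.isIdempotentElem.eq
    (hG.mul_eq_of_mul_eq h.mul_self_left hPb)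
    (hG'.mul_eq_of_mul_eq h.one_sub_left.mul_self_left hPc) hG.mul_eq hG'.mul_eq
    (h.commute_corner_projection hG)
    (h.one_sub_left.commute_corner_projection (by rwa [sub_sub_cancel]))
  have hT : star (P * (1 - Q)) = (1 - star Q) * P := by
    rw [star_mul, star_sub, star_one, h.star_left]
  rw [hT]
  refine isOrthoComplemented_of_isIdempotentElem hZi hZm fun x => ?_
  have hmem : ∀ y, (((1 - star Q) * P : Adjointable A H) : H →L[ℂ] H) y ∈
      rangeClosure ((1 - star Q) * P) := fun y =>
    opRange_le_rangeClosure ((1 - star Q) * P) (apply_mem_opRange ((1 - star Q) * P) y)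
  rw [hZ]
  refine Submodule.add_mem _ (Submodule.add_mem _ (hmem _) ?_) (hmem _)
  -- The only term not visibly in the range of (1-Q*)P is (1-Q*)G'. As G'x is a limit of vectors cy,
  -- the identity (1-Q*)c = (1-Q*)P·Q*P suffices.
  refine apply_mem_of_mem_rangeClosure (S := (1 - star Q : Adjointable A H)) (isClosed_rangeClosure _) (fun y => ?_)
    (hG'.apply_mem x)
  rw [← Adjointable.mul_apply, hc]
  exact hmem _

theorem hasPolarDecomposition [CompleteSpace H] (h : IsQuasiPair P Q)
    (h1 : IsOrthoComplemented A (rangeClosure (P * Q * (1 - P))))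
    (h2 : IsOrthoComplemented A (rangeClosure ((1 - P) * Q * P))) :
    HasPolarDecomposition (P * (1 - Q)) ∧ HasPolarDecomposition ((1 - P) * (1 - Q)) :=
  ⟨hasPolarDecomposition_of_isOrthoComplemented (h.isOrthoComplemented_mul_one_sub h1)
    (h.isOrthoComplemented_star_mul_one_sub h1 h2),
  hasPolarDecomposition_of_isOrthoComplemented
    (h.one_sub_left.isOrthoComplemented_mul_one_sub (by rwa [sub_sub_cancel]))
    (h.one_sub_left.isOrthoComplemented_star_mul_one_sub (by rwa [sub_sub_cancel])
      (by rwa [sub_sub_cancel]))⟩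

end IsQuasiPair

end QuasiProjectionPairs

/-! ### The equivalence. -/

theorem mainTheorem2 {A H : Type*} [NonUnitalCStarAlgebra A] [PartialOrder A] [StarOrderedRing A]
    [NormedAddCommGroup H] [NormedSpace ℂ H] [SMul A H] [CStarModule A H] [CompleteSpace H]
    (P Q : Adjointable A H) (hPQ : IsQuasiProjectionPair P Q) :
    IsHarmonious P Q ↔ IsSemiHarmonious P Q ∧ IsSemiHarmonious P (1 - Q) := by
  have h := hPQ.isQuasiPair
  have hPQ' := h.one_sub_right.isQuasiProjectionPair
  constructor
  · rintro ⟨-, h1, h2⟩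
    have hP := h.mul_self_left
    -- Replacing Q by 1-Q only changes the sign of the off-diagonal corners, so their range closures
    -- are unchanged.
    have e1 : P * (1 - Q) * (1 - P) = P * Q * (1 - P) * (-1) := by
      simp only [mul_sub, sub_mul, mul_one, mul_neg_one, hP]; abel
    have e2 : (1 - P) * (1 - Q) * P = (1 - P) * Q * P * (-1) := by
      simp only [mul_sub, sub_mul, mul_one, one_mul, mul_neg_one, hP]; abel
    obtain ⟨p1, p2⟩ := h.hasPolarDecomposition h1 h2
    obtain ⟨p3, p4⟩ := h.one_sub_right.hasPolarDecomposition
      (by rwa [e1, rangeClosure_mul_isUnit _ isUnit_one.neg])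
      (by rwa [e2, rangeClosure_mul_isUnit _ isUnit_one.neg])
    rw [sub_sub_cancel] at p4
    exact ⟨⟨hPQ, p1, p4⟩, ⟨hPQ', p3, p2⟩⟩
  · rintro ⟨⟨-, p1, p4⟩, ⟨-, p3, p2⟩⟩
    rw [sub_sub_cancel] at p3
    refine ⟨hPQ, h.isOrthoComplemented_upper p1 p3, ?_⟩
    simpa only [sub_sub_cancel] using h.one_sub_left.isOrthoComplemented_upper p2 p4
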